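/- Consider unweighted max-sat: an instance of size $n$ consists of $n$ Boolean variables $x_1,\dots,x_n$, listed in order of arrival, and a finite family of named clauses, each a set of literals (distinct names may carry the same set of literals), such that every variable occurs in some clause. The value of an assignment is the number of named clauses it satisfies, and $\mathrm{OPT}(I)$ is the maximum value over all assignments. In input model 0 the data item of a variable consists only of the names (and weights, all equal to $1$) of the clauses in which it appears positively and of those in which it appears negatively. A deterministic online width-$k$ algorithm knows $n$ and maintains a set of partial assignments, initially only the empty one. When the data item of $x_i$ arrives, each current partial assignment is irrevocably extended by a value of $x_i$ or is split into both extensions, on the basis of the data items received so far, $x_i$'s included, and the decisions made so far; no partial assignment may be discarded, and at no time may there be more than $k$ of them. The value $v(\mathbb A,I)$ obtained by the algorithm $\mathbb A$ on the instance $I$ is that of the best complete assignment it holds at the end. Theorem. For every constant $k$, every online width-$k$ algorithm $\mathbb A$ for unweighted max-sat in input model 0 has asymptotic approximation ratio strictly less than $2/3$, that is, $$\liminf_{n\to\infty}\ \inf_{I \text{ of size } n}\ \frac{v(\mathbb A,I)}{\mathrm{OPT}(I)} < \frac23 .$$ -/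

import Mathlib

open scoped ENNReal

namespace MaxSat

/-- A literal over the variables `x_0, …, x_{n-1}`: `(i, true)` is `x_i`, `(i, false)` is its
negation. -/
abbrev Literal (n : ℕ) : Type := Fin n × Bool

/-- An instance of unweighted max-sat of size `n` (i.e. with `n` data items), together with the
order of arrival: variable `i` is the one that arrives in step `i`. The clauses are identified by
names, so equal sets of literals may occur under several names. Every variable occurs in some
clause (this also rules out instances of optimal value zero, as soon as `n ≠ 0`). -/
structure Instance (n : ℕ) where
  /-- the finite set of clause names -/
  names : Finset ℕ
  /-- the set of literals of the clause with a given name -/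
  lits : ℕ → Finset (Literal n)
  /-- every variable occurs, positively or negatively, in some clause -/
  occurs : ∀ i : Fin n, ∃ c ∈ names, ∃ b : Bool, (i, b) ∈ lits c

/-- A data item in input model 0: the names of the clauses in which the variable appears
positively and the names of those in which it appears negatively (all weights are 1). -/
structure DataItem where
  /-- names of the clauses that contain the variable -/
  pos : Finset ℕ
  /-- names of the clauses that contain the negation of the variable -/
  neg : Finset ℕ

namespace Instance

variable {n : ℕ}

/-- The data item of variable `i`. -/
def item (I : Instance n) (i : Fin n) : DataItem where
  pos := I.names.filter fun c => (i, true) ∈ I.lits c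
  neg := I.names.filter fun c => (i, false) ∈ I.lits c

/-- The first `i` data items, the most recent one first. -/
def history (I : Instance n) (i : ℕ) : List DataItem :=
  ((List.ofFn I.item).take i).reverse

/-- The number of clauses satisfied by an assignment. -/
def numSat (I : Instance n) (a : Fin n → Bool) : ℕ :=
  (I.names.filter fun c => ∃ l ∈ I.lits c, a l.1 = l.2).card

/-- The optimal value: the largest number of clauses satisfied by an assignment. -/
def opt (I : Instance n) : ℕ :=
  Finset.univ.sup I.numSat

theorem opt_pos (hn : 0 < n) (I : Instance n) : 0 < I.opt := by
  obtain ⟨c, hc, b, hb⟩ := I.occurs ⟨0, hn⟩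
  refine lt_of_lt_of_le ?_ (Finset.le_sup (f := I.numSat) (Finset.mem_univ fun _ => b))
  exact Finset.card_pos.2 ⟨c, Finset.mem_filter.2 ⟨hc, _, hb, rfl⟩⟩

end Instance

/-- A deterministic online algorithm that maintains a tree of possible solutions, may branch at
any time and never cuts. It knows the size `n`. A partial solution is the list of the truth values
given to the variables seen so far, the most recent one first. When a data item arrives, the
partial solution `s` is replaced by its extensions by the values in `branch n h s`, where `h` is
the list of all the data items seen so far, the most recent one (that of the current variable)
first. Since the algorithm is deterministic, `h` determines the whole current tree. -/
structure OnlineAlgorithm where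
  /-- the truth values given to the current variable in the children of a node -/
  branch : (n : ℕ) → (h : List DataItem) → (s : List Bool) → Finset Bool
  /-- no cutting: every node has at least one child -/
  branch_nonempty : ∀ n h s, (branch n h s).Nonempty

namespace OnlineAlgorithm

/-- The set of possible solutions maintained after the data items in `h` (the most recent one
first) have been processed: one level of the tree. -/
def level (A : OnlineAlgorithm) (n : ℕ) : List DataItem → Finset (List Bool)
  | [] => {[]}
  | d :: h => (A.level n h).biUnion fun s => (A.branch n (d :: h) s).image fun b => b :: s

/-- The algorithm has width `k`: on every instance, at every point in time, it maintains at most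
`k` possible solutions. -/
def HasWidth (A : OnlineAlgorithm) (k : ℕ) : Prop :=
  ∀ (n : ℕ) (I : Instance n), ∀ i ≤ n, (A.level n (I.history i)).card ≤ k

/-- The assignment described by a complete solution (a list of length `n`, latest value first). -/
def toAssignment (n : ℕ) (s : List Bool) : Fin n → Bool :=
  fun i => s.reverse.getD i false

/-- The value obtained by the algorithm: that of the best solution it has at the end. -/
def value (A : OnlineAlgorithm) {n : ℕ} (I : Instance n) : ℕ :=
  (A.level n (I.history n)).sup fun s => I.numSat (toAssignment n s)

/-- The asymptotic approximation ratio: `liminf` over `n` of the infimum over the instances of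
size `n` of the ratio of the value obtained to the optimal value. -/
noncomputable def asymptoticRatio (A : OnlineAlgorithm) : ℝ≥0∞ :=
  Filter.liminf (fun n : ℕ => ⨅ I : Instance n, (A.value I : ℝ≥0∞) / (I.opt : ℝ≥0∞)) Filter.atTop

end OnlineAlgorithm

end MaxSat

/-! Since nothing is cut, a path to a maintained solution meets fewer than `k` branchings, so `2 ^
k` deterministic strategies, one for each string of choice bits, find every solution of a width-`k`
algorithm (`exists_play_eq`). It remains to defeat finitely many strategies at once.

For a weighted average over `m` strategies, an item splits `2 ^ m` clauses into halves `x`, `¬x`.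
The half satisfied by the heavier group is played on recursively; the optimum takes the other half
now and this one later. The heavy group gains nothing more, and the light group has fewer strategies
and at most half the weight. So the ratio obeys `r (m + 1) = 1 / 2 + r m / 4`, which stays below its
fixed point `2 / 3` (`exists_gadget`).

To bound every strategy rather than an average, the gadget is repeated on fresh clauses, weighted by
the current positive excesses, as in Blackwell approachability (`exists_repeated_gadget`). Excesses
are then of order `√N` after `N` gadgets, against an optimum linear in `N`. -/

namespace MaxSat

/-! ### Satisfied clauses computed from lists of items and values -/

/-- The clauses of a data item that are satisfied when the variable gets the value `b`. -/
def DataItem.side (d : DataItem) (b : Bool) : Finset ℕ := if b then d.pos else d.neg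

/-- The clauses in which the variable of a data item occurs. -/
def DataItem.clauses (d : DataItem) : Finset ℕ := d.pos ∪ d.neg

theorem DataItem.side_subset_clauses (d : DataItem) (b : Bool) : d.side b ⊆ d.clauses := by
  cases b
  · exact Finset.subset_union_right
  · exact Finset.subset_union_left

/-- The clauses satisfied by a solution `s` against the data items `h`, both latest first. -/
def satSet : List DataItem → List Bool → Finset ℕ
  | d :: h, b :: s => d.side b ∪ satSet h s
  | _, _ => ∅

theorem satSet_append {h h' : List DataItem} {s s' : List Bool} (hl : h.length = s.length) :
    satSet (h ++ h') (s ++ s') = satSet h s ∪ satSet h' s' := by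
  induction h generalizing s with
  | nil =>
    obtain rfl := List.eq_nil_of_length_eq_zero hl.symm
    simp [satSet]
  | cons d h ih =>
    cases s with
    | nil => simp at hl
    | cons b s => simp [satSet, ih (by simpa using hl), Finset.union_assoc]

theorem mem_satSet {h : List DataItem} {s : List Bool} {c : ℕ} :
    c ∈ satSet h s ↔ ∃ x ∈ h.zip s, c ∈ x.1.side x.2 := by
  induction h generalizing s with
  | nil => simp [satSet]
  | cons d h ih =>
    cases s with
    | nil => simp [satSet]
    | cons b s => simp only [satSet, Finset.mem_union, ih, List.zip_cons_cons, List.mem_cons,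
      exists_eq_or_imp]

theorem mem_satSet_iff_exists_fin {h : List DataItem} {s : List Bool} {n : ℕ} (hh : h.length = n)
    (hs : s.length = n) {c : ℕ} :
    c ∈ satSet h s ↔ ∃ i : Fin n, c ∈ (h.reverse[i.1]'(by simp [hh])).side
      (OnlineAlgorithm.toAssignment n s i) := by
  have hrev : (h.zip s).reverse = h.reverse.zip s.reverse :=
    List.reverse_zipWith (hh.trans hs.symm)
  have hx : (∃ x ∈ h.zip s, c ∈ x.1.side x.2) ↔
      ∃ x ∈ h.reverse.zip s.reverse, c ∈ x.1.side x.2 := by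
    rw [← hrev]
    simp only [List.mem_reverse]
  rw [mem_satSet, hx]
  constructor
  · rintro ⟨x, hx, hc⟩
    obtain ⟨i, hi, rfl⟩ := List.mem_iff_getElem.1 hx
    have hi' : i < n := by
      simp only [List.length_zip, List.length_reverse] at hi
      omega
    refine ⟨⟨i, hi'⟩, ?_⟩
    rw [List.getElem_zip] at hc
    have hb : i < s.reverse.length := by simp [hs, hi']
    simpa only [OnlineAlgorithm.toAssignment, List.getD_eq_getElem _ _ hb] using hc
  · rintro ⟨i, hc⟩
    have hb : i.1 < s.reverse.length := by simp [hs]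
    have hz : i.1 < (h.reverse.zip s.reverse).length := by simp [hs, hh]
    refine ⟨_, List.getElem_mem hz, ?_⟩
    rw [List.getElem_zip]
    simpa only [OnlineAlgorithm.toAssignment, List.getD_eq_getElem _ _ hb] using hc

theorem DataItem.nonempty_clauses_iff {d : DataItem} :
    d.clauses.Nonempty ↔ ∃ c, ∃ b, c ∈ d.side b := by
  simp [Finset.Nonempty, DataItem.clauses, DataItem.side, or_comm]

/-! ### Instances built from lists of items -/

/-- The instance with the given data items, latest first. -/
def Instance.ofItems {n : ℕ} (h : List DataItem) (hn : h.length = n)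
    (hne : ∀ d ∈ h, d.clauses.Nonempty) : Instance n where
  names := Finset.univ.biUnion fun i : Fin n => (h.reverse[i.1]'(by simp [hn])).clauses
  lits c := Finset.univ.filter fun l => c ∈ (h.reverse[l.1.1]'(by simp [hn])).side l.2
  occurs i := by
    have hi : i.1 < h.reverse.length := by simp [hn]
    obtain ⟨c, b, hc⟩ := DataItem.nonempty_clauses_iff.1
      (hne _ (List.mem_reverse.1 (List.getElem_mem hi)))
    refine ⟨c, ?_, b, by simpa using hc⟩
    exact Finset.mem_biUnion.2 ⟨i, Finset.mem_univ i, DataItem.side_subset_clauses _ b hc⟩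

namespace Instance

variable {n : ℕ} {h : List DataItem} (hn : h.length = n) (hne : ∀ d ∈ h, d.clauses.Nonempty)

theorem item_ofItems (i : Fin n) :
    (ofItems h hn hne).item i = h.reverse[i.1]'(by simp [hn]) := by
  have key (b : Bool) : ((ofItems h hn hne).names.filter fun c =>
      (i, b) ∈ (ofItems h hn hne).lits c) = (h.reverse[i.1]'(by simp [hn])).side b := by
    ext c
    simp only [ofItems, Finset.mem_filter, Finset.mem_univ, true_and, Finset.mem_biUnion,
      and_iff_right_iff_imp]
    exact fun hc => ⟨i, DataItem.side_subset_clauses _ b hc⟩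
  have h1 := key true
  have h2 := key false
  simp only [DataItem.side, if_true, Bool.false_eq_true, if_false] at h1 h2
  simp only [item, h1, h2]

theorem history_ofItems : (ofItems h hn hne).history n = h := by
  have hl : List.ofFn (ofItems h hn hne).item = h.reverse := by
    apply List.ext_getElem
    · simp [hn]
    · intro i h1 h2
      simp [item_ofItems]
  rw [history, hl, List.take_of_length_le (by simp [hn]), List.reverse_reverse]

theorem numSat_ofItems {s : List Bool} (hs : s.length = n) :
    (ofItems h hn hne).numSat (OnlineAlgorithm.toAssignment n s) = (satSet h s).card := by
  unfold numSat
  congr 1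
  ext c
  rw [mem_satSet_iff_exists_fin hn hs]
  simp only [ofItems, Finset.mem_filter, Finset.mem_univ, true_and, Finset.mem_biUnion]
  constructor
  · rintro ⟨-, ⟨i, b⟩, hc, hb⟩
    exact ⟨i, by simpa [hb] using hc⟩
  · rintro ⟨i, hc⟩
    exact ⟨⟨i, DataItem.side_subset_clauses _ _ hc⟩, ⟨i, _⟩, hc, rfl⟩

theorem card_satSet_le_opt {s : List Bool} (hs : s.length = n) :
    (satSet h s).card ≤ (ofItems h hn hne).opt := by
  rw [← numSat_ofItems hn hne hs]
  exact Finset.le_sup (f := (ofItems h hn hne).numSat) (Finset.mem_univ _)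

end Instance

/-! ### Reduction of a bounded-width tree to deterministic strategies -/

/-- The solution built by a deterministic strategy without branching. -/
def play (β : List DataItem → Bool) : List DataItem → List Bool
  | [] => []
  | d :: h => β (d :: h) :: play β h

theorem length_play (β : List DataItem → Bool) (h : List DataItem) :
    (play β h).length = h.length := by
  induction h with
  | nil => rfl
  | cons d h ih => simp [play, ih]

/-- The clauses satisfied by a deterministic strategy. -/
def covered (β : List DataItem → Bool) (h : List DataItem) : Finset ℕ := satSet h (play β h)

theorem covered_cons (β : List DataItem → Bool) (d : DataItem) (h : List DataItem) :
    covered β (d :: h) = d.side (β (d :: h)) ∪ covered β h := rfl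

namespace OnlineAlgorithm

variable (A : OnlineAlgorithm) (n : ℕ)

theorem card_level_cons (d : DataItem) (h : List DataItem) :
    (A.level n (d :: h)).card = ∑ s ∈ A.level n h, (A.branch n (d :: h) s).card := by
  rw [level, Finset.card_biUnion]
  · refine Finset.sum_congr rfl fun s _ => Finset.card_image_of_injective _ ?_
    intro b b' hb
    simpa using hb
  · intro s _ s' _ hss
    rw [Function.onFun, Finset.disjoint_left]
    intro t ht ht'
    obtain ⟨b, -, rfl⟩ := Finset.mem_image.1 ht
    obtain ⟨b', -, hb'⟩ := Finset.mem_image.1 ht'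
    exact hss (List.cons.inj hb').2.symm

/-- Every node other than `s` keeps at least one child, so a branching at `s` enlarges the level. -/
theorem card_level_add_card_branch_le {h : List DataItem} {s : List Bool} (hs : s ∈ A.level n h)
    (d : DataItem) :
    (A.level n h).card + (A.branch n (d :: h) s).card ≤ (A.level n (d :: h)).card + 1 := by
  rw [card_level_cons, ← Finset.add_sum_erase _ _ hs, ← Finset.card_erase_add_one hs]
  have : ((A.level n h).erase s).card ≤
      ∑ t ∈ (A.level n h).erase s, (A.branch n (d :: h) t).card := by
    rw [Finset.card_eq_sum_ones]
    exact Finset.sum_le_sum fun t _ => Finset.card_pos.2 (A.branch_nonempty _ _ _)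
  omega

/-- The solution obtained by following the tree of the algorithm, where `c j` tells which child to
take at the `j`-th branching node on the path, together with the number of such nodes. -/
def run (c : ℕ → Bool) : List DataItem → List Bool × ℕ
  | [] => ([], 0)
  | d :: h =>
    if (A.branch n (d :: h) (run c h).1).card = 2 then
      (c (run c h).2 :: (run c h).1, (run c h).2 + 1)
    -- With a single child, this is its value and no choice bit is consumed.
    else (decide (true ∈ A.branch n (d :: h) (run c h).1) :: (run c h).1, (run c h).2)

/-- The deterministic strategy obtained from the algorithm by fixing the choices at branchings. -/
def strategy (c : ℕ → Bool) (h : List DataItem) : Bool := (A.run n c h).1.headD false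

theorem play_strategy (c : ℕ → Bool) (h : List DataItem) :
    play (A.strategy n c) h = (A.run n c h).1 := by
  induction h with
  | nil => rfl
  | cons d h ih =>
    rw [play, ih, strategy, run]
    split <;> rfl

/-- Each branching on the path to `s` adds a further solution to the level, so `j` is less than its
size; only the first `j` choice bits matter. -/
theorem exists_run_eq {h : List DataItem} {s : List Bool} (hs : s ∈ A.level n h) :
    ∃ (j : ℕ) (c : ℕ → Bool), j + 1 ≤ (A.level n h).card ∧
      ∀ c' : ℕ → Bool, (∀ i < j, c' i = c i) → A.run n c' h = (s, j) := by
  induction h generalizing s with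
  | nil =>
    obtain rfl : s = [] := by simpa [level] using hs
    exact ⟨0, fun _ => false, by simp [level], fun c' _ => rfl⟩
  | cons d h ih =>
    obtain ⟨t, ht, hst⟩ := Finset.mem_biUnion.1 hs
    obtain ⟨b, hb, rfl⟩ := Finset.mem_image.1 hst
    obtain ⟨j, c, hj, hc⟩ := ih ht
    have hcard := A.card_level_add_card_branch_le n ht d
    by_cases h2 : (A.branch n (d :: h) t).card = 2
    · refine ⟨j + 1, Function.update c j b, by omega, fun c' hc' => ?_⟩
      have hrun := hc c' fun i hi => by
        rw [hc' i (by omega), Function.update_of_ne (by omega)]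
      rw [run, hrun, if_pos h2, hc' j (by omega), Function.update_self]
    · have hpos := Finset.card_pos.2 (A.branch_nonempty n (d :: h) t)
      refine ⟨j, c, by omega, fun c' hc' => ?_⟩
      rw [run, hc c' hc', if_neg h2]
      have h1 : (A.branch n (d :: h) t).card = 1 := by
        have := Finset.card_le_univ (A.branch n (d :: h) t)
        rw [Fintype.card_bool] at this
        omega
      obtain ⟨b', hb'⟩ := Finset.card_eq_one.1 h1
      rw [hb', Finset.mem_singleton] at hb
      subst hb
      cases b <;> simp [hb']

/-- Extension of a finite sequence of choices. -/
def extend {k : ℕ} (c : Fin k → Bool) (i : ℕ) : Bool := if hi : i < k then c ⟨i, hi⟩ else false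

theorem exists_play_eq {k : ℕ} {h : List DataItem} (hk : (A.level n h).card ≤ k) {s : List Bool}
    (hs : s ∈ A.level n h) : ∃ c : Fin k → Bool, play (A.strategy n (extend c)) h = s := by
  obtain ⟨j, c, hj, hc⟩ := A.exists_run_eq n hs
  refine ⟨fun i => c i, ?_⟩
  rw [play_strategy, hc]
  intro i hi
  simp [extend, show i < k by omega]

end OnlineAlgorithm

/-! ### The halving gadget -/

/-- The approximation ratio on the gadget with `2 ^ m` clauses, for weighted averages over `m`
strategies. -/
noncomputable def gadgetRatio : ℕ → ℝ
  | 0 => 0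
  | m + 1 => 1 / 2 + gadgetRatio m / 4

theorem gadgetRatio_nonneg (m : ℕ) : 0 ≤ gadgetRatio m := by
  induction m with
  | zero => exact le_rfl
  | succ m ih => rw [gadgetRatio]; positivity

theorem gadgetRatio_lt (m : ℕ) : gadgetRatio m < 2 / 3 := by
  induction m with
  | zero => norm_num [gadgetRatio]
  | succ m ih => rw [gadgetRatio]; linarith

/-- The adversary's gadget: in each step, the remaining clauses are halved, and the half that is
satisfied by the heavier group of strategies remains, while the optimum takes the other half. -/
theorem exists_gadget {ι : Type*} (β : ι → List DataItem → Bool) (w : ι → ℝ) (m : ℕ) :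
    ∀ (S : Finset ι) (B : Finset ℕ) (h : List DataItem), S.card ≤ m → (∀ i ∈ S, 0 < w i) →
      B.card = 2 ^ m →
      ∃ (g : List DataItem) (p : List Bool) (G : ι → Finset ℕ),
        g.length = m + 1 ∧ p.length = m + 1 ∧
        (∀ d ∈ g, d.clauses.Nonempty ∧ d.clauses ⊆ B) ∧ satSet g p = B ∧
        (∀ i, G i ⊆ B ∧ covered (β i) (g ++ h) = G i ∪ covered (β i) h) ∧
        ∑ i ∈ S, w i * (G i).card ≤ gadgetRatio m * 2 ^ m * ∑ i ∈ S, w i := by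
  induction m with
  | zero =>
    intro S B h hS _ hB
    obtain rfl : S = ∅ := Finset.card_eq_zero.1 (Nat.le_zero.1 hS)
    have hne : B.Nonempty := Finset.card_pos.1 (by rw [hB]; norm_num)
    refine ⟨[⟨B, ∅⟩], [true], fun i => (⟨B, ∅⟩ : DataItem).side (β i (⟨B, ∅⟩ :: h)),
      rfl, rfl, ?_, ?_, ?_, by simp⟩
    · simpa [DataItem.clauses] using hne
    · simp [satSet, DataItem.side]
    · intro i
      refine ⟨?_, rfl⟩
      simpa [DataItem.clauses] using
        DataItem.side_subset_clauses ⟨B, ∅⟩ (β i (⟨B, ∅⟩ :: h))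
  | succ m ih =>
    intro S B h hS hw hB
    obtain ⟨B₁, hB₁, hc₁⟩ := Finset.exists_subset_card_eq (s := B) (n := 2 ^ m)
      (by rw [hB, pow_succ]; omega)
    have hc₂ : (B \ B₁).card = 2 ^ m := by
      rw [Finset.card_sdiff_of_subset hB₁, hB, hc₁, pow_succ]; omega
    set d : DataItem := ⟨B₁, B \ B₁⟩
    have hside (b : Bool) : (d.side b).card = 2 ^ m := by cases b <;> simp [d, DataItem.side, *]
    have hclauses : d.clauses = B := Finset.union_sdiff_of_subset hB₁
    have hunion (b : Bool) : d.side b ∪ d.side (!b) = B := by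
      cases b
      · exact Finset.sdiff_union_of_subset hB₁
      · exact hclauses
    have hsub (b : Bool) : d.side b ⊆ B := hclauses ▸ d.side_subset_clauses b
    let T (b : Bool) : Finset ι := S.filter fun i => β i (d :: h) = b
    obtain ⟨b, hb⟩ : ∃ b, ∑ i ∈ T (!b), w i ≤ ∑ i ∈ T b, w i := by
      rcases le_total (∑ i ∈ T true, w i) (∑ i ∈ T false, w i) with hle | hle
      · exact ⟨false, hle⟩
      · exact ⟨true, hle⟩
    have hsplit (f : ι → ℝ) : ∑ i ∈ S, f i = ∑ i ∈ T b, f i + ∑ i ∈ T (!b), f i := by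
      rw [← Finset.sum_filter_add_sum_filter_not S fun i => β i (d :: h) = b]
      simp only [T, Bool.eq_not]
    have hTS (b : Bool) : T b ⊆ S := Finset.filter_subset _ _
    -- Weights are positive, so the heavier group is nonempty unless `S` is; the light group thus
    -- loses a strategy.
    have hTcard : (T (!b)).card ≤ m := by
      by_contra! hlt
      have hTeq : T (!b) = S := Finset.eq_of_subset_of_card_le (hTS _) (by omega)
      have hT0 : T b = ∅ := by
        refine Finset.eq_empty_of_forall_notMem fun i hi => ?_
        have h1 := hTS _ hi
        rw [← hTeq] at h1
        have h2 := (Finset.mem_filter.1 h1).2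
        rw [(Finset.mem_filter.1 hi).2] at h2
        cases b <;> simp at h2
      rw [hT0, hTeq, Finset.sum_empty] at hb
      have : 0 < ∑ i ∈ S, w i :=
        Finset.sum_pos hw (by rw [← hTeq]; exact Finset.card_pos.1 (by omega))
      linarith
    obtain ⟨g, p, G, hg, hp, hgB, hsat, hG, hsum⟩ :=
      ih (T (!b)) (d.side b) (d :: h) hTcard (fun i hi => hw i (hTS _ hi)) (hside b)
    -- Lists are latest first, so `d` is the first item of the gadget.
    refine ⟨g ++ [d], p ++ [!b], fun i => G i ∪ d.side (β i (d :: h)), by simp [hg],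
      by simp [hp], ?_, ?_, ?_, ?_⟩
    · intro e he
      rcases List.mem_append.1 he with he | he
      · exact ⟨(hgB e he).1, (hgB e he).2.trans (hsub b)⟩
      · obtain rfl := List.mem_singleton.1 he
        exact ⟨hclauses ▸ Finset.card_pos.1 (by rw [hB]; positivity), hclauses.subset⟩
    · rw [satSet_append (hg.trans hp.symm), hsat]
      simpa [satSet] using hunion b
    · intro i
      refine ⟨Finset.union_subset ((hG i).1.trans (hsub b)) (hsub _), ?_⟩
      rw [List.append_assoc, List.singleton_append, (hG i).2, covered_cons, Finset.union_assoc]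
    -- Later items involve only clauses that the heavy group has already satisfied.
    · have h1 : ∑ i ∈ T b, w i * ((G i ∪ d.side (β i (d :: h))).card : ℝ) =
          2 ^ m * ∑ i ∈ T b, w i := by
        rw [Finset.mul_sum]
        refine Finset.sum_congr rfl fun i hi => ?_
        rw [(Finset.mem_filter.1 hi).2, Finset.union_eq_right.2 (hG i).1, hside, mul_comm]
        push_cast
        rfl
      have h2 : ∑ i ∈ T (!b), w i * ((G i ∪ d.side (β i (d :: h))).card : ℝ) ≤
          2 ^ m * ∑ i ∈ T (!b), w i + ∑ i ∈ T (!b), w i * ((G i).card : ℝ) := by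
        rw [Finset.mul_sum, ← Finset.sum_add_distrib]
        refine Finset.sum_le_sum fun i hi => ?_
        have hle : ((G i ∪ d.side (β i (d :: h))).card : ℝ) ≤ (G i).card + 2 ^ m := by
          exact_mod_cast (Finset.card_union_le _ _).trans_eq (by rw [hside])
        nlinarith [mul_le_mul_of_nonneg_left hle (hw i (hTS _ hi)).le]
      rw [hsplit, hsplit w, gadgetRatio, pow_succ]
      have h3 : 0 ≤ gadgetRatio m * 2 ^ m * (∑ i ∈ T b, w i - ∑ i ∈ T (!b), w i) :=
        mul_nonneg (mul_nonneg (gadgetRatio_nonneg m) (by positivity)) (by linarith)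
      rw [h1]
      linarith

/-! ### Repetition of the gadget with adaptive weights -/

/-- Potential estimate for one round: the cross term is linear in the increment `d`, with the
positive part of `x` as weight. -/
theorem max_zero_add_sq_le (x d : ℝ) :
    (max 0 (x + d)) ^ 2 ≤ (max 0 x) ^ 2 + 2 * (max 0 x * d) + d ^ 2 := by
  have h1 : |max 0 (x + d)| ≤ |max 0 x + d| := by
    rw [abs_of_nonneg (le_max_left _ _)]
    exact max_le (abs_nonneg _) ((add_le_add_left (le_max_right 0 x) d).trans (le_abs_self _))
  nlinarith [sq_le_sq.2 h1]

/-- Repeating the gadget, with the excesses over the gadget ratio as weights, keeps the sum of the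
squares of the excesses linear in the number of gadgets. -/
theorem exists_repeated_gadget {ι : Type*} [Fintype ι] (β : ι → List DataItem → Bool) {m : ℕ}
    (hm : Fintype.card ι ≤ m) (N : ℕ) :
    ∃ (h : List DataItem) (p : List Bool),
      h.length = N * (m + 1) ∧ p.length = N * (m + 1) ∧ (∀ d ∈ h, d.clauses.Nonempty) ∧
      (satSet h p).card = N * 2 ^ m ∧
      (∃ M, satSet h p ⊆ Finset.range M ∧ ∀ i, covered (β i) h ⊆ Finset.range M) ∧
      ∑ i, (max 0 ((covered (β i) h).card - N * (gadgetRatio m * 2 ^ m))) ^ 2 ≤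
        N * (Fintype.card ι * (2 ^ m) ^ 2) := by
  induction N with
  | zero =>
    refine ⟨[], [], by simp, by simp, by simp, by simp [satSet], ⟨0, ?_, ?_⟩, ?_⟩ <;>
    simp [covered, satSet]
  | succ N ih =>
    obtain ⟨h, p, hh, hp, hne, hsat, ⟨M, hM, hcov⟩, hsum⟩ := ih
    set x : ι → ℝ := fun i => (covered (β i) h).card - N * (gadgetRatio m * 2 ^ m)
    -- Unused clause names, so that counts add up over the gadgets.
    set B := Finset.Ico M (M + 2 ^ m)
    have hBcard : B.card = 2 ^ m := by simp [B]
    have hdisj {C D : Finset ℕ} (hC : C ⊆ B) (hD : D ⊆ Finset.range M) : Disjoint C D := by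
      rw [Finset.disjoint_left]
      intro c hc hc'
      have h1 := Finset.mem_Ico.1 (hC hc)
      have h2 := Finset.mem_range.1 (hD hc')
      omega
    have hrange {C D : Finset ℕ} (hC : C ⊆ B) (hD : D ⊆ Finset.range M) :
        C ∪ D ⊆ Finset.range (M + 2 ^ m) := by
      refine Finset.union_subset (fun c hc => ?_) (hD.trans ?_)
      · exact Finset.mem_range.2 (Finset.mem_Ico.1 (hC hc)).2
      · exact Finset.range_subset_range.2 (Nat.le_add_right _ _)
    obtain ⟨g, q, G, hg, hq, hgB, hgsat, hG, hw⟩ := exists_gadget β (fun i => max 0 (x i)) m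
      (Finset.univ.filter fun i => 0 < max 0 (x i)) B h
      ((Finset.card_le_univ _).trans hm) (fun i hi => (Finset.mem_filter.1 hi).2) hBcard
    have hfilter (f : ι → ℝ) : ∑ i ∈ Finset.univ.filter (fun i => 0 < max 0 (x i)),
        max 0 (x i) * f i = ∑ i, max 0 (x i) * f i := by
      refine Finset.sum_filter_of_ne fun i _ hi => ?_
      exact lt_of_le_of_ne (le_max_left _ _) (left_ne_zero_of_mul hi).symm
    refine ⟨g ++ h, q ++ p, ?_, ?_, ?_, ?_, ⟨M + 2 ^ m, ?_, fun i => ?_⟩, ?_⟩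
    · rw [List.length_append, hg, hh]; ring
    · rw [List.length_append, hq, hp]; ring
    · intro d hd
      rcases List.mem_append.1 hd with hd | hd
      · exact (hgB d hd).1
      · exact hne d hd
    · rw [satSet_append (hg.trans hq.symm), hgsat,
        Finset.card_union_of_disjoint (hdisj subset_rfl hM), hBcard, hsat]
      ring
    · rw [satSet_append (hg.trans hq.symm), hgsat]
      exact hrange subset_rfl hM
    · rw [(hG i).2]
      exact hrange (hG i).1 (hcov i)
    · set δ : ι → ℝ := fun i => (G i).card - gadgetRatio m * 2 ^ m
      have hstep (i : ι) : ((covered (β i) (g ++ h)).card : ℝ) -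
          (N + 1 : ℕ) * (gadgetRatio m * 2 ^ m) = x i + δ i := by
        rw [(hG i).2, Finset.card_union_of_disjoint (hdisj (hG i).1 (hcov i))]
        simp only [x, δ]
        push_cast
        ring
      have hδsq (i : ι) : δ i ^ 2 ≤ (2 ^ m) ^ 2 := by
        have h1 : ((G i).card : ℝ) ≤ 2 ^ m := by
          exact_mod_cast (Finset.card_le_card (hG i).1).trans_eq hBcard
        have h2 : (0 : ℝ) ≤ (G i).card := Nat.cast_nonneg _
        have h3 : (0 : ℝ) < 2 ^ m := by positivity
        have h4 := gadgetRatio_nonneg m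
        have h5 := gadgetRatio_lt m
        refine sq_le_sq' ?_ ?_ <;> simp only [δ] <;> nlinarith
      -- The gadget bound makes the cross term nonpositive, so the potential grows only by the
      -- squared increments.
      have hwδ : ∑ i, max 0 (x i) * δ i ≤ 0 := by
        have h1 := hfilter fun _ => 1
        simp only [mul_one] at h1
        rw [hfilter fun i => ((G i).card : ℝ), h1] at hw
        simp only [δ, mul_sub, Finset.sum_sub_distrib, ← Finset.sum_mul]
        linarith
      calc _ = ∑ i, (max 0 (x i + δ i)) ^ 2 := by simp only [hstep]
        _ ≤ ∑ i, ((max 0 (x i)) ^ 2 + 2 * (max 0 (x i) * δ i) + (2 ^ m) ^ 2) :=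
          Finset.sum_le_sum fun i _ =>
            (max_zero_add_sq_le _ _).trans (add_le_add_right (hδsq i) _)
        _ = ∑ i, (max 0 (x i)) ^ 2 + 2 * ∑ i, max 0 (x i) * δ i +
            Fintype.card ι * (2 ^ m) ^ 2 := by
          simp [Finset.sum_add_distrib, Finset.mul_sum]
        _ ≤ _ := by push_cast; linarith

/-! ### Bad instances and the limit inferior -/

/-- A width-`k` algorithm is not much better than the gadget ratio on suitable instances, since all
the solutions it maintains are found by `2 ^ k` deterministic strategies. -/
theorem exists_instance_value_le {k : ℕ} {A : OnlineAlgorithm} (hA : A.HasWidth k) {ε : ℝ}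
    (hε : 0 < ε) {N : ℕ} (hN : (2 : ℝ) ^ k ≤ ε ^ 2 * N) :
    ∃ I : Instance (N * (2 ^ k + 1)),
      (A.value I : ℝ) ≤ (gadgetRatio (2 ^ k) + ε) * I.opt := by
  set n := N * (2 ^ k + 1)
  set m := 2 ^ k
  obtain ⟨h, p, hh, hp, hne, hsat, -, hsum⟩ := exists_repeated_gadget
    (fun c : Fin k → Bool => A.strategy n (OnlineAlgorithm.extend c)) (m := m) (by simp [m]) N
  refine ⟨Instance.ofItems h hh hne, ?_⟩
  have hopt : (N : ℝ) * 2 ^ m ≤ (Instance.ofItems h hh hne).opt := by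
    exact_mod_cast hsat ▸ Instance.card_satSet_le_opt hh hne hp
  have hwidth := hA n (Instance.ofItems h hh hne) n le_rfl
  rw [Instance.history_ofItems] at hwidth
  have hval (c : Fin k → Bool) :
      ((covered (A.strategy n (OnlineAlgorithm.extend c)) h).card : ℝ) ≤
        (gadgetRatio m + ε) * (N * 2 ^ m) := by
    have h1 := (Finset.single_le_sum (f := fun c : Fin k → Bool =>
      (max 0 (((covered (A.strategy n (OnlineAlgorithm.extend c)) h).card : ℝ) -
        N * (gadgetRatio m * 2 ^ m))) ^ 2) (fun _ _ => sq_nonneg _)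
        (Finset.mem_univ c)).trans hsum
    -- The hypothesis `hN` is what makes the accumulated potential at most the square of the allowed
    -- excess `ε * (N * 2 ^ m)`.
    have h2 : (N : ℝ) * (Fintype.card (Fin k → Bool) * (2 ^ m) ^ 2) ≤
        (ε * (N * 2 ^ m)) ^ 2 := by
      have : (N : ℝ) * 2 ^ k * (2 ^ m) ^ 2 ≤ N * (ε ^ 2 * N) * (2 ^ m) ^ 2 := by gcongr
      simp only [Fintype.card_fun, Fintype.card_bool, Fintype.card_fin]
      push_cast
      linarith
    have h3 := abs_le_of_sq_le_sq (h1.trans h2) (by positivity)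
    have h4 := (le_max_right 0 _).trans ((le_abs_self _).trans h3)
    linarith
  have hvalue : (A.value (Instance.ofItems h hh hne) : ℝ) ≤
      (gadgetRatio m + ε) * (N * 2 ^ m) := by
    have hnonneg : 0 ≤ (gadgetRatio m + ε) * (N * 2 ^ m) := by
      have := gadgetRatio_nonneg m
      positivity
    rw [← Nat.le_floor_iff hnonneg, OnlineAlgorithm.value, Instance.history_ofItems]
    refine Finset.sup_le fun s hs => ?_
    obtain ⟨c, rfl⟩ := A.exists_play_eq n hwidth hs
    rw [Instance.numSat_ofItems hh hne ((length_play _ h).trans hh), Nat.le_floor_iff hnonneg]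
    exact hval c
  exact hvalue.trans (mul_le_mul_of_nonneg_left hopt
    (add_nonneg (gadgetRatio_nonneg m) hε.le))

end MaxSat

theorem mainTheorem7 (k : ℕ) (A : MaxSat.OnlineAlgorithm) (hA : A.HasWidth k) :
    A.asymptoticRatio < 2 / 3 := by
  set r := MaxSat.gadgetRatio (2 ^ k)
  have hr0 : 0 ≤ r := MaxSat.gadgetRatio_nonneg _
  have hr1 : r < 2 / 3 := MaxSat.gadgetRatio_lt _
  obtain ⟨ε, hε, hε'⟩ : ∃ ε : ℝ, 0 < ε ∧ r + ε < 2 / 3 :=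
    ⟨(2 / 3 - r) / 2, by linarith, by linarith⟩
  have hle : A.asymptoticRatio ≤ ENNReal.ofReal (r + ε) := by
    -- Bad instances at arbitrarily large sizes suffice, so only multiples of `2 ^ k + 1` are used.
    refine Filter.liminf_le_of_frequently_le' (Filter.frequently_atTop.2 fun a => ?_)
    obtain ⟨N₀, hN₀⟩ := exists_nat_ge ((2 : ℝ) ^ k / ε ^ 2)
    set N := max (max N₀ a) 1
    have hNle : (2 : ℝ) ^ k ≤ ε ^ 2 * N := by
      rw [div_le_iff₀' (by positivity)] at hN₀
      have : (N₀ : ℝ) ≤ N := by exact_mod_cast (le_max_left _ _).trans (le_max_left _ _)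
      exact hN₀.trans (by gcongr)
    obtain ⟨I, hI⟩ := MaxSat.exists_instance_value_le hA hε hNle
    have haN : a ≤ N := (le_max_right _ _).trans (le_max_left _ _)
    have h1N : 1 ≤ N := le_max_right _ _
    refine ⟨N * (2 ^ k + 1), haN.trans (Nat.le_mul_of_pos_right _ (by positivity)),
      (iInf_le _ I).trans ?_⟩
    refine ENNReal.div_le_of_le_mul ?_
    rw [← ENNReal.ofReal_natCast, ← ENNReal.ofReal_natCast,
      ← ENNReal.ofReal_mul (by linarith)]
    exact ENNReal.ofReal_le_ofReal hI
  refine hle.trans_lt ?_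
  rw [ENNReal.ofReal_lt_iff_lt_toReal (by linarith) (ENNReal.div_ne_top (by simp) (by simp))]
  simpa using hε'
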